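/- Let $q$ be a complex number with $|q|<1$, and write $(x;q)_n=\prod_{k=0}^{n-1}(1-xq^k)$, $(x;q)_\infty=\prod_{k=0}^{\infty}(1-xq^k)$ and $(x_1,\dots,x_j;q)_\infty=(x_1;q)_\infty\cdots(x_j;q)_\infty$. Let $a$ and $b$ be non-zero complex numbers such that $a^2q^n\neq 1$ and $b^2q^n\neq 1$ for all $n\in\mathbb{Z}$ (if $q=0$, this means $a^2\ne 1$ and $b^2\neq 1$). Then both series below converge absolutely, and $$\begin{aligned} & \sum_{n=0}^{\infty} \frac{q^{2n^2+3n+1}}{1-q^{2n+1}} \left[ b^{2n+1} - a^{2n+1} + \frac{1}{a^{2n+1}} - \frac{1}{b^{2n+1}} \right] \\ & - \frac{1}{2} \sum_{n=1}^{\infty} \frac{(-1)^n q^{n(n+1)/2} (q; q)_{2n-1}}{(q; q)_n} \left[\frac{(1-aq^{2n})(a; q)_n}{(1-a)(qa^2; q)_{2n}} a^{2n} - \frac{(1+aq^{2n})(-a; q)_n}{(1+a)(qa^2; q)_{2n}} a^{2n} \right. \\ & \quad - \frac{(1-bq^{2n})(b; q)_n}{(1-b)(qb^2; q)_{2n}}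 b^{2n} + \frac{(1+bq^{2n})(-b; q)_n}{(1+b)(qb^2; q)_{2n}} b^{2n} \\ & \quad - \frac{(1-q^{2n}/a)(1/a; q)_n}{(1-1/a)(q/a^2; q)_{2n}} a^{-2n} + \frac{(1+q^{2n}/a)(-1/a; q)_n}{(1+1/a)(q/a^2; q)_{2n}} a^{-2n} \\ & \quad \left. + \frac{(1-q^{2n}/b)(1/b; q)_n}{(1-1/b)(q/b^2; q)_{2n}} b^{-2n} - \frac{(1+q^{2n}/b)(-1/b; q)_n}{(1+1/b)(q/b^2; q)_{2n}} b^{-2n} \right] \\ & = \frac{(a-b)(1+ab)}{(1-a^2)(1-b^2)} - a\, \frac{(b/a,\, qa/b,\, -ab,\, -q/(ab);\, q)_{\infty}\, (q^2, q^2; q^2)_{\infty}}{(a^2,\, q^2/a^2,\, b^2,\, q^2/b^2;\, q^2)_{\infty}}. \end{aligned}$$ -/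

import Mathlib

/-- The finite `q`-shifted factorial `(x; q)_n = (1 - x)(1 - xq) ⋯ (1 - xq^(n-1))`. -/
noncomputable def qPoch (x q : ℂ) (n : ℕ) : ℂ :=
  ∏ k ∈ Finset.range n, (1 - x * q ^ k)

/-- The infinite `q`-shifted factorial `(x; q)_∞ = (1 - x)(1 - xq)(1 - xq^2) ⋯`. -/
noncomputable def qPochInf (x q : ℂ) : ℂ :=
  ∏' k : ℕ, (1 - x * q ^ k)

/-- For `|q| < 1` the infinite product `(x; q)_∞` converges, to the limit of the `(x; q)_n`. -/
theorem tendsto_qPoch_qPochInf (x : ℂ) {q : ℂ} (hq : ‖q‖ < 1) :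
    Filter.Tendsto (qPoch x q) Filter.atTop (nhds (qPochInf x q)) := by
  have hs : Summable fun k : ℕ => ‖-(x * q ^ k)‖ := by
    simp only [norm_neg, norm_mul, norm_pow]
    exact (summable_geometric_of_lt_one (norm_nonneg q) hq).mul_left _
  have hm : Multipliable fun k : ℕ => 1 - x * q ^ k := by
    simpa [sub_eq_add_neg] using multipliable_one_add_of_summable hs
  exact hm.hasProd.tendsto_prod_nat

/-- The term of index `n` (`n ≥ 0`) of the Lambert-type series. -/
noncomputable def lambertTerm (a b q : ℂ) (n : ℕ) : ℂ :=
  q ^ (2 * n ^ 2 + 3 * n + 1) / (1 - q ^ (2 * n + 1)) *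
    (b ^ (2 * n + 1) - a ^ (2 * n + 1) + 1 / a ^ (2 * n + 1) - 1 / b ^ (2 * n + 1))

/-- The term of index `n` (`n ≥ 1`) of the well-poised series. -/
noncomputable def wellPoisedTerm (a b q : ℂ) (n : ℕ) : ℂ :=
  (-1) ^ n * q ^ (n * (n + 1) / 2) * qPoch q q (2 * n - 1) / qPoch q q n *
    ( (1 - a * q ^ (2 * n)) * qPoch a q n
        / ((1 - a) * qPoch (q * a ^ 2) q (2 * n)) * a ^ (2 * n)
    - (1 + a * q ^ (2 * n)) * qPoch (-a) q n
        / ((1 + a) * qPoch (q * a ^ 2) q (2 * n)) * a ^ (2 * n)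
    - (1 - b * q ^ (2 * n)) * qPoch b q n
        / ((1 - b) * qPoch (q * b ^ 2) q (2 * n)) * b ^ (2 * n)
    + (1 + b * q ^ (2 * n)) * qPoch (-b) q n
        / ((1 + b) * qPoch (q * b ^ 2) q (2 * n)) * b ^ (2 * n)
    - (1 - q ^ (2 * n) / a) * qPoch (1 / a) q n
        / ((1 - 1 / a) * qPoch (q / a ^ 2) q (2 * n)) * (1 / a ^ (2 * n))
    + (1 + q ^ (2 * n) / a) * qPoch (-1 / a) q n
        / ((1 + 1 / a) * qPoch (q / a ^ 2) q (2 * n)) * (1 / a ^ (2 * n))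
    + (1 - q ^ (2 * n) / b) * qPoch (1 / b) q n
        / ((1 - 1 / b) * qPoch (q / b ^ 2) q (2 * n)) * (1 / b ^ (2 * n))
    - (1 + q ^ (2 * n) / b) * qPoch (-1 / b) q n
        / ((1 + 1 / b) * qPoch (q / b ^ 2) q (2 * n)) * (1 / b ^ (2 * n)) )

/-! Write `S x` for the series
`∑_{m ≥ 1} c_m (1 - x q^{2m}) (x; q)_m / ((1 - x) (q x²; q)_{2m}) x^{2m}` with
`c_m = (-1)^m q^{m(m+1)/2} (q; q)_{2m-1} / (q; q)_m`. A telescoping certificate gives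
`S x - (1 - x q) S (x q) - x q S (x q²)` as a rational function of `x`. Iterating, `S x - S (x q)`
is a rational function plus a partial theta function, and its odd part shows that `S x - S (-x)`
and `2 (∑_{m ≥ 1} x q^m / (1 - x² q^{2m}) - L x)`, where `L` is a Lambert series,
change by the same amount under `x ↦ x q`; both tend to `0` as `x → 0`, so they are equal. In the
combination of `x = a, b, 1/a, 1/b` at hand the series `L` cancel, and the remaining sums form
the bilateral series `∑_{m ∈ ℤ} x q^m / (1 - x² q^{2m})` at `a` and `b`. The difference of these
two is the partial fraction expansion of an elliptic theta quotient: as functions of `a` both sides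
are invariant under `a ↦ a q`, have the same principal parts at `±1` and agree at `a = b`, so they
coincide by Liouville's theorem. -/

open Filter Topology

theorem qPoch_zero (x q : ℂ) : qPoch x q 0 = 1 := by simp [qPoch]

theorem qPoch_succ (x q : ℂ) (n : ℕ) : qPoch x q (n + 1) = qPoch x q n * (1 - x * q ^ n) :=
  Finset.prod_range_succ _ _

theorem qPoch_add (x q : ℂ) (m n : ℕ) :
    qPoch x q (m + n) = qPoch x q m * qPoch (x * q ^ m) q n := by
  simp only [qPoch, Finset.prod_range_add, pow_add, mul_assoc]

theorem qPoch_succ_left (x q : ℂ) (n : ℕ) :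
    qPoch x q (n + 1) = (1 - x) * qPoch (x * q) q n := by
  rw [add_comm, qPoch_add, qPoch_succ, qPoch_zero, pow_zero, pow_one, one_mul, mul_one]

theorem qPoch_ne_zero {x q : ℂ} (h : ∀ k : ℕ, x * q ^ k ≠ 1) (n : ℕ) : qPoch x q n ≠ 0 :=
  Finset.prod_ne_zero_iff.2 fun k _ => sub_ne_zero.2 (h k).symm

theorem norm_mul_pow_le (x : ℂ) {q : ℂ} (hq : ‖q‖ < 1) (k : ℕ) : ‖x * q ^ k‖ ≤ ‖x‖ := by
  rw [norm_mul, norm_pow]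
  exact mul_le_of_le_one_right (norm_nonneg _) (pow_le_one₀ (norm_nonneg _) hq.le)

theorem norm_one_sub_mul_pow_le (x : ℂ) {q : ℂ} (hq : ‖q‖ < 1) (k : ℕ) :
    ‖1 - x * q ^ k‖ ≤ 1 + ‖x‖ := by
  refine (norm_sub_le _ _).trans ?_
  rw [norm_one]
  exact add_le_add_right (norm_mul_pow_le x hq k) 1

theorem one_sub_norm_le_norm_one_sub {y q : ℂ} (h : ‖y‖ ≤ ‖q‖) : 1 - ‖q‖ ≤ ‖1 - y‖ := by
  have := norm_sub_norm_le 1 y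
  rw [norm_one] at this
  linarith

theorem norm_qPoch_le (x : ℂ) {q : ℂ} (hq : ‖q‖ < 1) (n : ℕ) : ‖qPoch x q n‖ ≤ (1 + ‖x‖) ^ n := by
  rw [qPoch, norm_prod]
  simpa using Finset.prod_le_prod (s := Finset.range n) (fun _ _ => norm_nonneg _)
    fun k _ => norm_one_sub_mul_pow_le x hq k

theorem pow_le_norm_qPoch {x q : ℂ} {m : ℝ} (hm : 0 ≤ m) (h : ∀ k : ℕ, m ≤ ‖1 - x * q ^ k‖)
    (n : ℕ) : m ^ n ≤ ‖qPoch x q n‖ := by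
  rw [qPoch, norm_prod]
  simpa using Finset.prod_le_prod (s := Finset.range n) (fun _ _ => hm) fun k _ => h k

theorem pow_succ_ne_one {q : ℂ} (hq : ‖q‖ < 1) (n : ℕ) : q ^ (n + 1) ≠ 1 := fun h => by
  have hlt := pow_lt_one₀ (norm_nonneg q) hq n.succ_ne_zero
  rw [← norm_pow, h, norm_one] at hlt
  exact lt_irrefl 1 hlt

theorem qPoch_self_ne_zero {q : ℂ} (hq : ‖q‖ < 1) (n : ℕ) : qPoch q q n ≠ 0 :=
  qPoch_ne_zero (fun k => by rw [← pow_succ']; exact pow_succ_ne_one hq k) n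

theorem tendsto_mul_pow_nhds_zero (x : ℂ) {q : ℂ} (hq : ‖q‖ < 1) :
    Tendsto (fun N : ℕ => x * q ^ N) atTop (𝓝 0) := by
  simpa using (tendsto_pow_atTop_nhds_zero_of_norm_lt_one hq).const_mul x

theorem exists_pos_le_norm_one_sub {x q : ℂ} (hq : ‖q‖ < 1) (h : ∀ k : ℕ, x * q ^ k ≠ 1) :
    ∃ m : ℝ, 0 < m ∧ ∀ k : ℕ, m ≤ ‖1 - x * q ^ k‖ := by
  have hpos : ∀ k : ℕ, 0 < ‖1 - x * q ^ k‖ := fun k => norm_pos_iff.2 (sub_ne_zero.2 (h k).symm)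
  have hlim : Tendsto (fun k : ℕ => ‖1 - x * q ^ k‖⁻¹) atTop (𝓝 1) := by
    simpa using ((tendsto_mul_pow_nhds_zero x hq).const_sub 1).norm.inv₀ (by simp)
  obtain ⟨M, hM⟩ := hlim.bddAbove_range
  have hMk : ∀ k : ℕ, ‖1 - x * q ^ k‖⁻¹ ≤ M := fun k => hM ⟨k, rfl⟩
  have hMpos : 0 < M := (inv_pos.2 (hpos 0)).trans_le (hMk 0)
  exact ⟨M⁻¹, inv_pos.2 hMpos, fun k => inv_le_of_inv_le₀ (hpos k) (hMk k)⟩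

theorem summable_pow_mul_pow {K r : ℝ} (hK : 0 ≤ K) (hr : 0 ≤ r) (hr1 : r < 1) {e : ℕ → ℕ}
    (he : ∀ N, ∀ᶠ n in atTop, N * n ≤ e n) : Summable fun n => K ^ n * r ^ e n := by
  have hlim : Tendsto (fun N : ℕ => K * r ^ N) atTop (𝓝 0) := by
    simpa using (tendsto_pow_atTop_nhds_zero_of_lt_one hr hr1).const_mul K
  obtain ⟨N, hN⟩ := (hlim.eventually_lt_const one_half_pos).exists
  refine Summable.of_norm_bounded_eventually_nat summable_geometric_two ?_
  filter_upwards [he N] with n hn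
  rw [Real.norm_of_nonneg (by positivity)]
  calc K ^ n * r ^ e n ≤ K ^ n * r ^ (N * n) := by
        gcongr ?_ * ?_
        exact pow_le_pow_of_le_one hr hr1.le hn
    _ = (K * r ^ N) ^ n := by rw [mul_pow, pow_mul]
    _ ≤ (1 / 2) ^ n := pow_le_pow_left₀ (by positivity) hN.le n

theorem tendsto_tsum_nhds_zero {E F : Type*} [NormedAddCommGroup E] [NormedAddCommGroup F]
    {u : E → ℕ → F} {c : ℕ → ℝ} (hc : Summable c)
    (h : ∀ y, ‖y‖ ≤ 1 → ∀ n, ‖u y n‖ ≤ ‖y‖ * c n) :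
    Tendsto (fun y => ∑' n, u y n) (𝓝 0) (𝓝 0) := by
  refine squeeze_zero_norm' (a := fun y : E => ‖y‖ * ∑' n, c n) ?_ ?_
  · filter_upwards [Metric.closedBall_mem_nhds (0 : E) one_pos] with y hy
    exact tsum_of_norm_bounded (hc.hasSum.mul_left _) (h y (mem_closedBall_zero_iff.1 hy))
  · simpa using (tendsto_norm_zero (E := E)).mul_const (∑' n, c n)

theorem triangle_succ (n : ℕ) : (n + 1) * (n + 2) / 2 = n * (n + 1) / 2 + (n + 1) := by
  rw [show (n + 1) * (n + 2) = n * (n + 1) + (n + 1) * 2 by ring,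
    Nat.add_mul_div_right _ _ two_pos]

theorem eventually_mul_le_triangle (N : ℕ) : ∀ᶠ n in atTop, N * n ≤ n * (n + 1) / 2 := by
  filter_upwards [eventually_ge_atTop (2 * N)] with n hn
  rw [Nat.le_div_iff_mul_le two_pos]
  nlinarith

theorem eventually_mul_le_triangle_succ (N : ℕ) :
    ∀ᶠ n in atTop, N * n ≤ (n + 1) * (n + 2) / 2 := by
  filter_upwards [eventually_mul_le_triangle N] with n hn
  rw [triangle_succ]
  lia

/-- The coefficient `(-1) ^ m * q ^ (m * (m + 1) / 2) * (q; q)_{2m-1} / (q; q)_m` of the well-poised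
series, indexed by `n = m - 1`. -/
noncomputable def wellPoisedCoeff (q : ℂ) (n : ℕ) : ℂ :=
  (-1) ^ (n + 1) * q ^ ((n + 1) * (n + 2) / 2) * qPoch q q (2 * n + 1) / qPoch q q (n + 1)

theorem wellPoisedCoeff_zero {q : ℂ} (hq : ‖q‖ < 1) : wellPoisedCoeff q 0 = -q := by
  have h : qPoch q q 1 ≠ 0 := qPoch_self_ne_zero hq 1
  rw [wellPoisedCoeff]
  field_simp
  norm_num

theorem wellPoisedCoeff_succ {q : ℂ} (hq : ‖q‖ < 1) (n : ℕ) :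
    wellPoisedCoeff q (n + 1) * (1 - q * q ^ (n + 1)) =
      -(q * q ^ (n + 1)) * wellPoisedCoeff q n * (1 - (q ^ (n + 1)) ^ 2) *
        (1 - q * (q ^ (n + 1)) ^ 2) := by
  have h1 := qPoch_self_ne_zero hq (n + 1)
  have h2 : 1 - q * q ^ (n + 1) ≠ 0 := by
    rw [← pow_succ']; exact sub_ne_zero.2 (pow_succ_ne_one hq _).symm
  rw [wellPoisedCoeff, wellPoisedCoeff, show 2 * (n + 1) + 1 = 2 * n + 1 + 1 + 1 by ring,
    qPoch_succ q q (2 * n + 1 + 1), qPoch_succ q q (2 * n + 1), qPoch_succ q q (n + 1),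
    show n + 1 + 2 = (n + 1) + 1 + 1 by ring, triangle_succ (n + 1)]
  field_simp
  ring

theorem norm_wellPoisedCoeff_le {q : ℂ} (hq : ‖q‖ < 1) (n : ℕ) :
    ‖wellPoisedCoeff q n‖ ≤ 2 ^ n * ‖q‖ ^ ((n + 1) * (n + 2) / 2) := by
  have hcancel : wellPoisedCoeff q n =
      (-1) ^ (n + 1) * q ^ ((n + 1) * (n + 2) / 2) * qPoch (q * q ^ (n + 1)) q n := by
    rw [wellPoisedCoeff, show 2 * n + 1 = n + 1 + n by ring, qPoch_add]
    field_simp [qPoch_self_ne_zero hq (n + 1)]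
  have hpoch : ‖qPoch (q * q ^ (n + 1)) q n‖ ≤ 2 ^ n := by
    refine (norm_qPoch_le _ hq n).trans (pow_le_pow_left₀ (by positivity) ?_ n)
    linarith [norm_mul_pow_le q hq (n + 1)]
  rw [hcancel, norm_mul, norm_mul, norm_pow, norm_pow, norm_neg, norm_one, one_pow, one_mul,
    mul_comm]
  gcongr

/-- The term of index `n + 1` of the one-variable well-poised series
`∑ c_m (1 - x q^{2m}) (x; q)_m / ((1 - x) (q x²; q)_{2m}) x^{2m}`, without its factor
`1 - x q^{2m}` and with the factor `1 - x` cancelled. -/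
noncomputable def wellPoisedKernel (x q : ℂ) (n : ℕ) : ℂ :=
  wellPoisedCoeff q n * x ^ (2 * (n + 1)) * qPoch (x * q) q n / qPoch (x ^ 2 * q) q (2 * (n + 1))

/-- The one-variable well-poised series, of which the series of the theorem is a combination. -/
noncomputable def wellPoisedSum (x q : ℂ) : ℂ :=
  ∑' n, wellPoisedKernel x q n * (1 - x * q ^ (2 * (n + 1)))

theorem sq_mul_pow_succ_ne_one_mul_pow {x q : ℂ} (hx : ∀ k : ℕ, x ^ 2 * q ^ (k + 1) ≠ 1)
    (N k : ℕ) : (x * q ^ N) ^ 2 * q ^ (k + 1) ≠ 1 := by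
  convert hx (2 * N + k) using 1
  ring

theorem one_sub_sq_mul_pow_ne_zero {x q : ℂ} (hx : ∀ k : ℕ, x ^ 2 * q ^ (k + 1) ≠ 1) {k : ℕ}
    (hk : k ≠ 0) : 1 - x ^ 2 * q ^ k ≠ 0 := by
  obtain ⟨k, rfl⟩ := Nat.exists_eq_succ_of_ne_zero hk
  exact sub_ne_zero.2 (hx k).symm

theorem norm_wellPoisedKernel_le {x q : ℂ} (hq : ‖q‖ < 1) {m : ℝ} (hm : 0 < m)
    (h : ∀ k : ℕ, m ≤ ‖1 - x ^ 2 * q * q ^ k‖) (n : ℕ) :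
    ‖wellPoisedKernel x q n‖ ≤ ‖x‖ ^ 2 / m ^ 2 *
      ((2 * (1 + ‖x‖) * ‖x‖ ^ 2 / m ^ 2) ^ n * ‖q‖ ^ ((n + 1) * (n + 2) / 2)) := by
  have hnum : ‖qPoch (x * q) q n‖ ≤ (1 + ‖x‖) ^ n := by
    refine (norm_qPoch_le _ hq n).trans ?_
    gcongr
    simpa using norm_mul_pow_le x hq 1
  calc ‖wellPoisedKernel x q n‖
      = ‖wellPoisedCoeff q n‖ * ‖x‖ ^ (2 * (n + 1)) * ‖qPoch (x * q) q n‖ /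
          ‖qPoch (x ^ 2 * q) q (2 * (n + 1))‖ := by
        rw [wellPoisedKernel, norm_div, norm_mul, norm_mul, norm_pow]
    _ ≤ 2 ^ n * ‖q‖ ^ ((n + 1) * (n + 2) / 2) * ‖x‖ ^ (2 * (n + 1)) * (1 + ‖x‖) ^ n /
          m ^ (2 * (n + 1)) := by
        gcongr
        · exact norm_wellPoisedCoeff_le hq n
        · exact pow_le_norm_qPoch hm.le h _
    _ = _ := by
        rw [mul_add_one 2 n, pow_add, pow_add m, pow_mul, pow_mul m, div_pow, mul_pow, mul_pow]
        field_simp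

theorem summable_norm_wellPoisedKernel {x q : ℂ} (hq : ‖q‖ < 1)
    (hx : ∀ k : ℕ, x ^ 2 * q ^ (k + 1) ≠ 1) : Summable fun n => ‖wellPoisedKernel x q n‖ := by
  obtain ⟨m, hm, h⟩ := exists_pos_le_norm_one_sub (x := x ^ 2 * q) hq fun k => by
    simpa only [mul_assoc, ← pow_succ'] using hx k
  exact Summable.of_nonneg_of_le (fun _ => norm_nonneg _) (norm_wellPoisedKernel_le hq hm h)
    ((summable_pow_mul_pow (by positivity) (norm_nonneg _) hq
      eventually_mul_le_triangle_succ).mul_left _)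

theorem hasSum_wellPoisedSum {x q : ℂ} (hq : ‖q‖ < 1) (hx : ∀ k : ℕ, x ^ 2 * q ^ (k + 1) ≠ 1) :
    HasSum (fun n => wellPoisedKernel x q n * (1 - x * q ^ (2 * (n + 1)))) (wellPoisedSum x q) :=
  (Summable.of_norm_bounded ((summable_norm_wellPoisedKernel hq hx).mul_right (1 + ‖x‖))
    fun n => by
      rw [norm_mul]
      exact mul_le_mul_of_nonneg_left (norm_one_sub_mul_pow_le x hq _) (norm_nonneg _)).hasSum

theorem tendsto_wellPoisedSum_nhds_zero {q : ℂ} (hq : ‖q‖ < 1) :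
    Tendsto (fun x => wellPoisedSum x q) (𝓝 0) (𝓝 0) := by
  have hm : 0 < 1 - ‖q‖ := sub_pos.2 hq
  refine tendsto_tsum_nhds_zero ((summable_pow_mul_pow (K := 4 / (1 - ‖q‖) ^ 2) (by positivity)
    (norm_nonneg q) hq eventually_mul_le_triangle_succ).mul_left (2 / (1 - ‖q‖) ^ 2))
    fun x hx n => ?_
  have hden : ∀ k : ℕ, 1 - ‖q‖ ≤ ‖1 - x ^ 2 * q * q ^ k‖ := fun k =>
    one_sub_norm_le_norm_one_sub <| (norm_mul_pow_le _ hq k).trans <| by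
      rw [norm_mul, norm_pow]
      exact mul_le_of_le_one_left (norm_nonneg q) (pow_le_one₀ (norm_nonneg x) hx)
  have hsq : ‖x‖ ^ 2 ≤ ‖x‖ := pow_le_of_le_one (norm_nonneg x) hx two_ne_zero
  have hbase : 2 * (1 + ‖x‖) * ‖x‖ ^ 2 ≤ 4 := by nlinarith [norm_nonneg x]
  calc ‖wellPoisedKernel x q n * (1 - x * q ^ (2 * (n + 1)))‖
      ≤ ‖x‖ / (1 - ‖q‖) ^ 2 * ((4 / (1 - ‖q‖) ^ 2) ^ n * ‖q‖ ^ ((n + 1) * (n + 2) / 2)) * 2 := by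
        rw [norm_mul]
        gcongr
        · refine (norm_wellPoisedKernel_le hq hm hden n).trans ?_
          gcongr
        · linarith [norm_one_sub_mul_pow_le x hq (2 * (n + 1))]
    _ = _ := by ring

/-! ### The recurrence of the well-poised series -/

theorem wellPoisedKernel_mul_right {x q : ℂ} (hx : ∀ k : ℕ, x ^ 2 * q ^ (k + 1) ≠ 1) (n : ℕ) :
    (1 - x ^ 2 * q * (q ^ (n + 1)) ^ 2) * (1 - x ^ 2 * q ^ 2 * (q ^ (n + 1)) ^ 2) *
        wellPoisedKernel (x * q) q n =
      (1 - x ^ 2 * q) * (1 + x * q) * (q ^ (n + 1)) ^ 2 * (1 - x * q ^ (n + 1)) *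
        wellPoisedKernel x q n := by
  have hnum : (1 - x * q) * qPoch (x * q * q) q n =
      qPoch (x * q) q n * (1 - x * q ^ (n + 1)) := by
    rw [← qPoch_succ_left, qPoch_succ, mul_assoc x, ← pow_succ']
  have hden : (1 - x ^ 2 * q) * (1 - x ^ 2 * q ^ 2) * qPoch ((x * q) ^ 2 * q) q (2 * (n + 1)) =
      qPoch (x ^ 2 * q) q (2 * (n + 1)) * (1 - x ^ 2 * q * (q ^ (n + 1)) ^ 2) *
        (1 - x ^ 2 * q ^ 2 * (q ^ (n + 1)) ^ 2) := by
    have h := (qPoch_add (x ^ 2 * q) q 2 (2 * (n + 1))).symm.trans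
      ((congrArg _ (add_comm _ _)).trans (qPoch_add _ _ _ _))
    simp only [qPoch_succ, qPoch_zero, pow_zero, pow_one, one_mul, mul_one] at h
    rw [show (x * q) ^ 2 * q = x ^ 2 * q * q ^ 2 by ring]
    convert h using 1 <;> ring
  have hreg {z : ℂ} (hz : ∀ k : ℕ, z ^ 2 * q ^ (k + 1) ≠ 1) :
      qPoch (z ^ 2 * q) q (2 * (n + 1)) ≠ 0 :=
    qPoch_ne_zero (fun k => by simpa only [mul_assoc, ← pow_succ'] using hz k) _
  have hA := hreg hx
  have hB := hreg (by simpa only [pow_one] using sq_mul_pow_succ_ne_one_mul_pow hx 1)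
  have hcancel : 1 - x * q ≠ 0 := fun h =>
    one_sub_sq_mul_pow_ne_zero hx two_ne_zero (by linear_combination (1 + x * q) * h)
  rw [wellPoisedKernel, wellPoisedKernel]
  generalize qPoch ((x * q) ^ 2 * q) q (2 * (n + 1)) = B at hB hden ⊢
  rw [mul_div_assoc', mul_div_assoc', div_eq_div_iff hB hA, mul_pow x q]
  refine mul_left_cancel₀ hcancel ?_
  linear_combination
    wellPoisedCoeff q n * x ^ (2 * (n + 1)) * q ^ (2 * (n + 1)) * (
      (1 - x ^ 2 * q * (q ^ (n + 1)) ^ 2) * (1 - x ^ 2 * q ^ 2 * (q ^ (n + 1)) ^ 2) *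
        qPoch (x ^ 2 * q) q (2 * (n + 1)) * hnum
      - qPoch (x * q) q n * (1 - x * q ^ (n + 1)) * hden)

theorem wellPoisedKernel_succ {x q : ℂ} (hq : ‖q‖ < 1) (hx : ∀ k : ℕ, x ^ 2 * q ^ (k + 1) ≠ 1)
    (n : ℕ) :
    (1 - q * q ^ (n + 1)) * (1 - x ^ 2 * q * (q ^ (n + 1)) ^ 2) *
        (1 - x ^ 2 * q ^ 2 * (q ^ (n + 1)) ^ 2) * wellPoisedKernel x q (n + 1) =
      -(q * q ^ (n + 1)) * (1 - (q ^ (n + 1)) ^ 2) * (1 - q * (q ^ (n + 1)) ^ 2) * x ^ 2 *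
        (1 - x * q ^ (n + 1)) * wellPoisedKernel x q n := by
  have hA : ∀ m, qPoch (x ^ 2 * q) q m ≠ 0 := fun m =>
    qPoch_ne_zero (fun k => by simpa only [mul_assoc, ← pow_succ'] using hx k) m
  have hden : qPoch (x ^ 2 * q) q (2 * (n + 1 + 1)) = qPoch (x ^ 2 * q) q (2 * (n + 1)) *
      (1 - x ^ 2 * q * (q ^ (n + 1)) ^ 2) * (1 - x ^ 2 * q ^ 2 * (q ^ (n + 1)) ^ 2) := by
    rw [mul_add_one 2 (n + 1), qPoch_succ, qPoch_succ]
    ring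
  rw [wellPoisedKernel, wellPoisedKernel, mul_div_assoc', mul_div_assoc',
    div_eq_div_iff (hA _) (hA _), hden, qPoch_succ, mul_add_one 2 (n + 1), pow_add]
  linear_combination x ^ (2 * (n + 1)) * x ^ 2 * qPoch (x * q) q n *
    (1 - x * q ^ (n + 1)) * (1 - x ^ 2 * q * (q ^ (n + 1)) ^ 2) *
    (1 - x ^ 2 * q ^ 2 * (q ^ (n + 1)) ^ 2) * qPoch (x ^ 2 * q) q (2 * (n + 1)) *
    wellPoisedCoeff_succ hq n

/-- The numerator, as a polynomial in `Q = q ^ (n + 1)`, of the rational certificate that makes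
the second order `q`-difference equation of `wellPoisedSum` telescope (found by the `q`-analogue of
Zeilberger's algorithm). -/
noncomputable def certificateNumerator (x q Q : ℂ) : ℂ :=
  (1 - Q) * (-1 + (x ^ 2 * q - 1) * Q + (x + x ^ 2 * q + x ^ 2 * q ^ 2 - x ^ 3 * q) * Q ^ 2 +
    (x ^ 5 * q ^ 4 - x ^ 3 * q ^ 3) * Q ^ 3 - x ^ 6 * q ^ 4 * Q ^ 4)

/-- The telescoping certificate: the rational function of `Q = q ^ (n + 1)` by which
`wellPoisedKernel x q n` is multiplied in `wellPoisedKernel_recurrence`. -/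
noncomputable def certificate (x q Q : ℂ) : ℂ :=
  certificateNumerator x q Q / ((1 - x ^ 2 * q * Q ^ 2) * (1 - x ^ 2 * q ^ 2 * Q ^ 2))

theorem wellPoisedKernel_recurrence {x q : ℂ} (hq : ‖q‖ < 1)
    (hx : ∀ k : ℕ, x ^ 2 * q ^ (k + 1) ≠ 1) (n : ℕ) :
    wellPoisedKernel x q n * (1 - x * q ^ (2 * (n + 1))) -
        (1 - x * q) * (wellPoisedKernel (x * q) q n * (1 - x * q * q ^ (2 * (n + 1)))) -
        x * q * (wellPoisedKernel (x * q ^ 2) q n * (1 - x * q ^ 2 * q ^ (2 * (n + 1)))) =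
      wellPoisedKernel x q (n + 1) * certificate x q (q ^ (n + 1 + 1)) -
        wellPoisedKernel x q n * certificate x q (q ^ (n + 1)) := by
  have hshift := wellPoisedKernel_mul_right hx n
  have hshift₂ := wellPoisedKernel_mul_right
    (by simpa only [pow_one] using sq_mul_pow_succ_ne_one_mul_pow hx 1) n
  have hsucc := wellPoisedKernel_succ hq hx n
  have hf : ∀ i, i ≠ 0 → 1 - x ^ 2 * q ^ i * (q ^ (n + 1)) ^ 2 ≠ 0 := fun i _ => by
    rw [mul_assoc, ← pow_mul, ← pow_add]
    exact one_sub_sq_mul_pow_ne_zero hx (by lia)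
  have hf₁ := hf 1 one_ne_zero
  have hf₂ := hf 2 two_ne_zero
  have hf₃ := hf 3 three_ne_zero
  have hf₄ := hf 4 four_ne_zero
  simp only [certificate, pow_succ' q (n + 1), mul_comm 2 (n + 1), pow_mul]
  generalize q ^ (n + 1) = Q at *
  rw [mul_assoc x q q, ← pow_two] at hshift₂
  have hcert : ∀ z, z / ((1 - x ^ 2 * q * (q * Q) ^ 2) * (1 - x ^ 2 * q ^ 2 * (q * Q) ^ 2)) =
      z / ((1 - x ^ 2 * q ^ 3 * Q ^ 2) * (1 - x ^ 2 * q ^ 4 * Q ^ 2)) := fun z => by ring_nf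
  rw [pow_one] at hf₁
  rw [hcert, mul_div_assoc', mul_div_assoc', div_sub_div _ _ (mul_ne_zero hf₃ hf₄)
    (mul_ne_zero hf₁ hf₂), eq_div_iff (mul_ne_zero (mul_ne_zero hf₃ hf₄) (mul_ne_zero hf₁ hf₂))]
  simp only [certificateNumerator]
  linear_combination
    (-(1 - x * q) * (1 - x * q * Q ^ 2) * (1 - x ^ 2 * q ^ 3 * Q ^ 2) *
        (1 - x ^ 2 * q ^ 4 * Q ^ 2) - x * q * (1 - x * q ^ 2 * Q ^ 2) * (1 - x ^ 2 * q ^ 3) *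
        (1 + x * q ^ 2) * Q ^ 2 * (1 - x * q * Q)) * hshift -
    x * q * (1 - x * q ^ 2 * Q ^ 2) * (1 - x ^ 2 * q * Q ^ 2) * (1 - x ^ 2 * q ^ 2 * Q ^ 2) *
      hshift₂ -
    (-1 + (x ^ 2 * q - 1) * (q * Q) + (x + x ^ 2 * q + x ^ 2 * q ^ 2 - x ^ 3 * q) * (q * Q) ^ 2 +
      (x ^ 5 * q ^ 4 - x ^ 3 * q ^ 3) * (q * Q) ^ 3 - x ^ 6 * q ^ 4 * (q * Q) ^ 4) * hsucc

theorem tendsto_wellPoisedKernel_mul_certificate {x q : ℂ} (hq : ‖q‖ < 1)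
    (hx : ∀ k : ℕ, x ^ 2 * q ^ (k + 1) ≠ 1) :
    Tendsto (fun n => wellPoisedKernel x q n * certificate x q (q ^ (n + 1))) atTop (𝓝 0) := by
  have hcert : ContinuousAt (certificate x q) 0 := by
    unfold certificate certificateNumerator
    fun_prop (disch := simp)
  simpa using (summable_norm_wellPoisedKernel hq hx).of_norm.tendsto_atTop_zero.mul
    (hcert.tendsto.comp ((tendsto_pow_atTop_nhds_zero_of_norm_lt_one hq).comp
      (tendsto_add_atTop_nat 1)))

theorem wellPoisedSum_recurrence {x q : ℂ} (hq : ‖q‖ < 1)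
    (hx : ∀ k : ℕ, x ^ 2 * q ^ (k + 1) ≠ 1) :
    wellPoisedSum x q - (1 - x * q) * wellPoisedSum (x * q) q -
        x * q * wellPoisedSum (x * q ^ 2) q =
      -(wellPoisedKernel x q 0 * certificate x q q) := by
  have h0 := hasSum_wellPoisedSum hq hx
  have h1 := hasSum_wellPoisedSum hq
    (by simpa only [pow_one] using sq_mul_pow_succ_ne_one_mul_pow hx 1)
  have h2 := hasSum_wellPoisedSum hq (sq_mul_pow_succ_ne_one_mul_pow hx 2)
  refine tendsto_nhds_unique
    ((h0.sub (h1.mul_left (1 - x * q))).sub (h2.mul_left (x * q))).tendsto_sum_nat ?_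
  simp only [wellPoisedKernel_recurrence hq hx,
    Finset.sum_range_sub fun n => wellPoisedKernel x q n * certificate x q (q ^ (n + 1))]
  simpa using (tendsto_wellPoisedKernel_mul_certificate hq hx).sub_const
    (wellPoisedKernel x q 0 * certificate x q q)

/-- The rational part of `wellPoisedSum x q - wellPoisedSum (x * q) q`. -/
noncomputable def rationalPart (x q : ℂ) : ℂ :=
  x * q / (1 - x ^ 2 * q ^ 2) - 1 / (1 - x ^ 2 * q)

theorem wellPoisedKernel_zero_mul_certificate {x q : ℂ} (hq : ‖q‖ < 1)
    (hx : ∀ k : ℕ, x ^ 2 * q ^ (k + 1) ≠ 1) :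
    -(wellPoisedKernel x q 0 * certificate x q q) =
      1 + rationalPart x q + x * q * rationalPart (x * q) q := by
  have h1 : 1 - x ^ 2 * q ≠ 0 := by simpa using one_sub_sq_mul_pow_ne_zero hx one_ne_zero
  have h2 := one_sub_sq_mul_pow_ne_zero hx two_ne_zero
  have h3 := one_sub_sq_mul_pow_ne_zero hx three_ne_zero
  have h4 := one_sub_sq_mul_pow_ne_zero hx four_ne_zero
  have hkernel : wellPoisedKernel x q 0 =
      -q * x ^ 2 / ((1 - x ^ 2 * q) * (1 - x ^ 2 * q ^ 2)) := by
    simp only [wellPoisedKernel, wellPoisedCoeff_zero hq, zero_add, mul_one, qPoch_zero,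
      qPoch_succ, pow_zero, one_mul, pow_one]
    ring_nf
  have hcert : certificate x q q =
      certificateNumerator x q q / ((1 - x ^ 2 * q ^ 3) * (1 - x ^ 2 * q ^ 4)) := by
    rw [certificate]
    ring_nf
  have hshift : rationalPart (x * q) q =
      x * q ^ 2 / (1 - x ^ 2 * q ^ 4) - 1 / (1 - x ^ 2 * q ^ 3) := by
    rw [rationalPart]
    ring_nf
  rw [hkernel, hcert, hshift, rationalPart, certificateNumerator]
  generalize hd1 : 1 - x ^ 2 * q = d1 at *
  generalize hd2 : 1 - x ^ 2 * q ^ 2 = d2 at *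
  generalize hd3 : 1 - x ^ 2 * q ^ 3 = d3 at *
  generalize hd4 : 1 - x ^ 2 * q ^ 4 = d4 at *
  field_simp
  rw [← hd1, ← hd2, ← hd3, ← hd4]
  ring

/-- The partial theta function `∑ (-x) ^ j * q ^ (j * (j + 1) / 2)`. -/
noncomputable def partialTheta (x q : ℂ) : ℂ := ∑' j : ℕ, (-x) ^ j * q ^ (j * (j + 1) / 2)

theorem hasSum_partialTheta (x : ℂ) {q : ℂ} (hq : ‖q‖ < 1) :
    HasSum (fun j : ℕ => (-x) ^ j * q ^ (j * (j + 1) / 2)) (partialTheta x q) := by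
  refine (Summable.of_norm ?_).hasSum
  simp only [norm_mul, norm_pow]
  exact summable_pow_mul_pow (norm_nonneg _) (norm_nonneg q) hq eventually_mul_le_triangle

theorem eq_partialTheta_of_recurrence {x q l : ℂ} (hq : ‖q‖ < 1) {u : ℕ → ℂ}
    (hu : Tendsto u atTop (𝓝 l)) (h : ∀ N, u N = 1 - x * q ^ (N + 1) * u (N + 1)) :
    u 0 = partialTheta x q := by
  have hiter : ∀ N, u 0 = (∑ j ∈ Finset.range N, (-x) ^ j * q ^ (j * (j + 1) / 2)) +
      (-x) ^ N * q ^ (N * (N + 1) / 2) * u N := fun N => by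
    induction N with
    | zero => simp
    | succ N ih =>
      rw [ih, Finset.sum_range_succ, h N, triangle_succ]
      ring
  have hsum := hasSum_partialTheta x hq
  refine tendsto_nhds_unique ((tendsto_const_nhds (f := atTop)).congr hiter) ?_
  simpa using hsum.tendsto_sum_nat.add (hsum.summable.tendsto_atTop_zero.mul hu)

theorem wellPoisedSum_sub_mul_right {x q : ℂ} (hq : ‖q‖ < 1)
    (hx : ∀ k : ℕ, x ^ 2 * q ^ (k + 1) ≠ 1) :
    wellPoisedSum x q - wellPoisedSum (x * q) q = rationalPart x q + partialTheta x q := by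
  let u : ℕ → ℂ := fun N => wellPoisedSum (x * q ^ N) q - wellPoisedSum (x * q ^ (N + 1)) q -
    rationalPart (x * q ^ N) q
  have hrec : ∀ N, u N = 1 - x * q ^ (N + 1) * u (N + 1) := fun N => by
    have hxN := sq_mul_pow_succ_ne_one_mul_pow hx N
    have h := (wellPoisedSum_recurrence hq hxN).trans (wellPoisedKernel_zero_mul_certificate hq hxN)
    simp only [u]
    simp only [mul_assoc, ← pow_succ, ← pow_add] at h ⊢
    linear_combination h
  have hlim : Tendsto u atTop (𝓝 (0 - 0 - rationalPart 0 q)) := by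
    have hH := (tendsto_wellPoisedSum_nhds_zero hq).comp (tendsto_mul_pow_nhds_zero x hq)
    have hρ : ContinuousAt (rationalPart · q) 0 := by
      unfold rationalPart
      fun_prop (disch := simp)
    exact (hH.sub (hH.comp (tendsto_add_atTop_nat 1))).sub
      (hρ.tendsto.comp (tendsto_mul_pow_nhds_zero x hq))
  have key := eq_partialTheta_of_recurrence hq hlim hrec
  simp only [u, pow_zero, zero_add, mul_one, pow_one] at key
  linear_combination key

theorem partialTheta_sub_neg (x : ℂ) {q : ℂ} (hq : ‖q‖ < 1) :
    partialTheta x q - partialTheta (-x) q =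
      -2 * ∑' n : ℕ, q ^ ((2 * n + 1) * (n + 1)) * x ^ (2 * n + 1) := by
  have hinj : Function.Injective fun n : ℕ => 2 * n + 1 := fun m n h => by simpa using h
  rw [← ((hasSum_partialTheta x hq).sub (hasSum_partialTheta (-x) hq)).tsum_eq,
    ← hinj.tsum_eq, ← tsum_mul_left]
  · refine tsum_congr fun n => ?_
    rw [show (2 * n + 1) * (2 * n + 1 + 1) = (2 * n + 1) * (n + 1) * 2 by ring,
      Nat.mul_div_cancel _ two_pos, neg_neg, Odd.neg_pow ⟨n, rfl⟩]
    ring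
  · refine Function.support_subset_iff'.2 fun j hj => ?_
    have heven : Even j := Nat.not_odd_iff_even.1 fun ⟨n, hn⟩ => hj ⟨n, hn.symm⟩
    rw [heven.neg_pow, neg_neg, sub_self]

/-- The term of index `n + 1` of `∑_{m ≥ 1} x q^m / (1 - x² q^{2m})`. -/
noncomputable def bilateralHalfTerm (x q : ℂ) (n : ℕ) : ℂ :=
  x * q ^ (n + 1) / (1 - x ^ 2 * q ^ (2 * (n + 1)))

/-- The positive half `∑_{m ≥ 1} x q^m / (1 - x² q^{2m})` of the bilateral series
`∑_{m ∈ ℤ} x q^m / (1 - x² q^{2m})`. -/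
noncomputable def bilateralHalf (x q : ℂ) : ℂ := ∑' n, bilateralHalfTerm x q n

theorem bilateralHalfTerm_add (x q : ℂ) (n N : ℕ) :
    bilateralHalfTerm x q (n + N) = bilateralHalfTerm (x * q ^ N) q n := by
  rw [bilateralHalfTerm, bilateralHalfTerm]
  ring_nf

theorem norm_bilateralHalfTerm_le {x q : ℂ} (hq : ‖q‖ < 1) (hx : ‖x‖ ≤ 1) (n : ℕ) :
    ‖bilateralHalfTerm x q n‖ ≤ ‖x‖ * (‖q‖ ^ (n + 1) / (1 - ‖q‖)) := by
  have : 0 < 1 - ‖q‖ := sub_pos.2 hq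
  have hden : 1 - ‖q‖ ≤ ‖1 - x ^ 2 * q ^ (2 * (n + 1))‖ := by
    refine one_sub_norm_le_norm_one_sub ?_
    rw [norm_mul, norm_pow, norm_pow]
    exact (mul_le_of_le_one_left (by positivity) (pow_le_one₀ (norm_nonneg x) hx)).trans
      (pow_le_of_le_one (norm_nonneg q) hq.le (by lia))
  rw [bilateralHalfTerm, norm_div, norm_mul, norm_pow, mul_div_assoc]
  gcongr

theorem summable_norm_pow_succ_div {q : ℂ} (hq : ‖q‖ < 1) (c : ℝ) :
    Summable fun n : ℕ => ‖q‖ ^ (n + 1) / c :=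
  ((summable_nat_add_iff 1).2 (summable_geometric_of_lt_one (norm_nonneg q) hq)).div_const c

theorem exists_norm_mul_pow_lt_one (x : ℂ) {q : ℂ} (hq : ‖q‖ < 1) : ∃ N : ℕ, ‖x * q ^ N‖ < 1 :=
  ((tendsto_zero_iff_norm_tendsto_zero.1 (tendsto_mul_pow_nhds_zero x hq)).eventually_lt_const
    one_pos).exists

theorem hasSum_bilateralHalf (x : ℂ) {q : ℂ} (hq : ‖q‖ < 1) :
    HasSum (bilateralHalfTerm x q) (bilateralHalf x q) := by
  obtain ⟨N, hN⟩ := exists_norm_mul_pow_lt_one x hq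
  refine ((summable_nat_add_iff N).1 ?_).hasSum
  simp only [bilateralHalfTerm_add]
  exact Summable.of_norm_bounded ((summable_norm_pow_succ_div hq _).mul_left _)
    (norm_bilateralHalfTerm_le hq hN.le)

theorem bilateralHalf_eq_sum_add (x : ℂ) {q : ℂ} (hq : ‖q‖ < 1) (N : ℕ) :
    bilateralHalf x q =
      (∑ n ∈ Finset.range N, bilateralHalfTerm x q n) + bilateralHalf (x * q ^ N) q := by
  rw [bilateralHalf, ← (hasSum_bilateralHalf x hq).summable.sum_add_tsum_nat_add N]
  simp only [bilateralHalfTerm_add, bilateralHalf]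

theorem bilateralHalf_eq_add (x : ℂ) {q : ℂ} (hq : ‖q‖ < 1) :
    bilateralHalf x q = x * q / (1 - x ^ 2 * q ^ 2) + bilateralHalf (x * q) q := by
  simpa [bilateralHalfTerm] using bilateralHalf_eq_sum_add x hq 1

theorem tendsto_bilateralHalf_nhds_zero {q : ℂ} (hq : ‖q‖ < 1) :
    Tendsto (fun x => bilateralHalf x q) (𝓝 0) (𝓝 0) :=
  tendsto_tsum_nhds_zero (summable_norm_pow_succ_div hq _) fun _ => norm_bilateralHalfTerm_le hq

/-- The term of index `n` of the one-variable Lambert-type series. -/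
noncomputable def lambertHalfTerm (x q : ℂ) (n : ℕ) : ℂ :=
  q ^ ((2 * n + 1) * (n + 1)) / (1 - q ^ (2 * n + 1)) * x ^ (2 * n + 1)

/-- The one-variable Lambert-type series, of which the Lambert series of the theorem is a
combination. -/
noncomputable def lambertHalf (x q : ℂ) : ℂ := ∑' n, lambertHalfTerm x q n

theorem norm_lambertHalfTerm_le (x : ℂ) {q : ℂ} (hq : ‖q‖ < 1) (n : ℕ) :
    ‖lambertHalfTerm x q n‖ ≤
      ‖x‖ * ((1 - ‖q‖)⁻¹ * ((‖x‖ ^ 2) ^ n * ‖q‖ ^ ((2 * n + 1) * (n + 1)))) := by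
  have : 0 < 1 - ‖q‖ := sub_pos.2 hq
  have hden : 1 - ‖q‖ ≤ ‖1 - q ^ (2 * n + 1)‖ := by
    refine one_sub_norm_le_norm_one_sub ?_
    rw [norm_pow]
    exact pow_le_of_le_one (norm_nonneg q) hq.le (by lia)
  calc ‖lambertHalfTerm x q n‖
      = ‖q‖ ^ ((2 * n + 1) * (n + 1)) / ‖1 - q ^ (2 * n + 1)‖ * ‖x‖ ^ (2 * n + 1) := by
        rw [lambertHalfTerm, norm_mul, norm_div, norm_pow, norm_pow]
    _ ≤ ‖q‖ ^ ((2 * n + 1) * (n + 1)) / (1 - ‖q‖) * ‖x‖ ^ (2 * n + 1) := by gcongr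
    _ = _ := by ring

theorem summable_pow_mul_pow_odd_triangle {K : ℝ} (hK : 0 ≤ K) {q : ℂ} (hq : ‖q‖ < 1) :
    Summable fun n : ℕ => K ^ n * ‖q‖ ^ ((2 * n + 1) * (n + 1)) :=
  summable_pow_mul_pow hK (norm_nonneg q) hq fun N => by
    filter_upwards [eventually_ge_atTop N] with n hn
    nlinarith

theorem hasSum_lambertHalf (x : ℂ) {q : ℂ} (hq : ‖q‖ < 1) :
    HasSum (lambertHalfTerm x q) (lambertHalf x q) :=
  (Summable.of_norm_bounded (((summable_pow_mul_pow_odd_triangle (by positivity) hq).mul_left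
    _).mul_left _) (norm_lambertHalfTerm_le x hq)).hasSum

theorem lambertHalf_sub_mul_right (x : ℂ) {q : ℂ} (hq : ‖q‖ < 1) :
    lambertHalf x q - lambertHalf (x * q) q =
      ∑' n : ℕ, q ^ ((2 * n + 1) * (n + 1)) * x ^ (2 * n + 1) := by
  rw [← ((hasSum_lambertHalf x hq).sub (hasSum_lambertHalf (x * q) hq)).tsum_eq]
  refine tsum_congr fun n => ?_
  have h : 1 - q ^ (2 * n + 1) ≠ 0 := sub_ne_zero.2 (pow_succ_ne_one hq (2 * n)).symm
  rw [lambertHalfTerm, lambertHalfTerm, mul_pow]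
  field_simp

theorem tendsto_lambertHalf_nhds_zero {q : ℂ} (hq : ‖q‖ < 1) :
    Tendsto (fun x => lambertHalf x q) (𝓝 0) (𝓝 0) := by
  refine tendsto_tsum_nhds_zero
    ((summable_pow_mul_pow_odd_triangle zero_le_one hq).mul_left (1 - ‖q‖)⁻¹) fun x hx n => ?_
  have : 0 ≤ (1 - ‖q‖)⁻¹ := inv_nonneg.2 (sub_nonneg.2 hq.le)
  have hx2 : ‖x‖ ^ 2 ≤ 1 := pow_le_one₀ (norm_nonneg x) hx
  refine (norm_lambertHalfTerm_le x hq n).trans ?_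
  gcongr

theorem wellPoisedSum_sub_neg {x q : ℂ} (hq : ‖q‖ < 1) (hx : ∀ k : ℕ, x ^ 2 * q ^ (k + 1) ≠ 1) :
    wellPoisedSum x q - wellPoisedSum (-x) q = 2 * (bilateralHalf x q - lambertHalf x q) := by
  let D : ℂ → ℂ := fun x => wellPoisedSum x q - wellPoisedSum (-x) q -
    2 * (bilateralHalf x q - lambertHalf x q)
  have hD_mul : ∀ x : ℂ, (∀ k : ℕ, x ^ 2 * q ^ (k + 1) ≠ 1) → D (x * q) = D x := fun x hx => by
    have hpos := wellPoisedSum_sub_mul_right hq hx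
    have hneg := wellPoisedSum_sub_mul_right (x := -x) hq (by simpa only [neg_sq] using hx)
    have hodd : rationalPart x q - rationalPart (-x) q = 2 * (x * q / (1 - x ^ 2 * q ^ 2)) := by
      simp only [rationalPart, neg_sq]
      ring
    rw [neg_mul] at hneg
    linear_combination -hpos + hneg - hodd + 2 * bilateralHalf_eq_add x hq -
      2 * lambertHalf_sub_mul_right x hq - partialTheta_sub_neg x hq
  have hD_mul_pow : ∀ N : ℕ, D (x * q ^ N) = D x := fun N => by
    induction N with
    | zero => rw [pow_zero, mul_one]
    | succ N ih =>
      rw [← ih, ← hD_mul _ (sq_mul_pow_succ_ne_one_mul_pow hx N), mul_assoc, ← pow_succ]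
  have hD_lim : Tendsto D (𝓝 0) (𝓝 (0 - 0 - 2 * (0 - 0))) := by
    have hneg : Tendsto (fun y : ℂ => -y) (𝓝 0) (𝓝 0) := by
      simpa using (continuous_neg (G := ℂ)).tendsto 0
    have hH := tendsto_wellPoisedSum_nhds_zero hq
    exact (hH.sub (hH.comp hneg)).sub (((tendsto_bilateralHalf_nhds_zero hq).sub
      (tendsto_lambertHalf_nhds_zero hq)).const_mul 2)
  have hDx : D x = 0 := by
    simpa only [sub_zero, mul_zero] using
      tendsto_nhds_unique ((tendsto_const_nhds (f := atTop)).congr fun N => (hD_mul_pow N).symm)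
        (hD_lim.comp (tendsto_mul_pow_nhds_zero x hq))
  exact sub_eq_zero.1 hDx

/-! ### Elliptic functions in multiplicative form -/

/-- `f` agrees near `c`, apart from `c` itself, with a function analytic at `c`. The elliptic
functions below are known up to such removable singularities, where their values are junk. -/
def RemovableAt (f : ℂ → ℂ) (c : ℂ) : Prop :=
  ∃ g : ℂ → ℂ, AnalyticAt ℂ g c ∧ f =ᶠ[𝓝[≠] c] g

namespace RemovableAt

variable {f : ℂ → ℂ} {c : ℂ}

theorem congr {g : ℂ → ℂ} (hg : RemovableAt g c) (hfg : f =ᶠ[𝓝[≠] c] g) : RemovableAt f c :=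
  let ⟨h, hh, hgh⟩ := hg
  ⟨h, hh, hfg.trans hgh⟩

theorem meromorphicAt (hf : RemovableAt f c) : MeromorphicAt f c :=
  let ⟨_, hg, hfg⟩ := hf
  hg.meromorphicAt.congr hfg.symm

theorem meromorphicOrderAt_nonneg (hf : RemovableAt f c) : 0 ≤ meromorphicOrderAt f c :=
  hf.meromorphicAt.meromorphicOrderAt_nonneg_iff.2 hf

theorem comp_mul_const {w : ℂ} (hw : w ≠ 0) (hf : RemovableAt f (c * w)) :
    RemovableAt (fun z => f (z * w)) c :=
  let ⟨g, hg, hfg⟩ := hf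
  ⟨fun z => g (z * w), hg.comp (f := fun z => z * w) (by fun_prop),
    (hasDerivAt_mul_const w).tendsto_nhdsNE hw |>.eventually hfg⟩

theorem div_one_sub_sq {W : ℂ → ℂ} (hW : AnalyticAt ℂ W c) (hc : c ^ 2 = 1 → W c = 0) :
    RemovableAt (fun z => W z / (1 - z ^ 2)) c := by
  by_cases h : c ^ 2 = 1
  · have hcc : c + c ≠ 0 := by
      rw [← two_mul]
      exact mul_ne_zero two_ne_zero (by rintro rfl; norm_num at h)
    obtain ⟨p, hp⟩ := hW
    refine ⟨fun z => -dslope W c z / (z + c), ?_, ?_⟩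
    · exact hp.has_fpower_series_dslope_fslope.analyticAt.neg.div
        (analyticAt_id.add analyticAt_const) hcc
    · filter_upwards [self_mem_nhdsWithin] with z hz
      rw [dslope_of_ne _ hz, slope_def_field, hc h, sub_zero,
        show 1 - z ^ 2 = -((z - c) * (z + c)) by rw [← h]; ring, div_neg, neg_div, div_div]
  · have hden : 1 - c ^ 2 ≠ 0 := sub_ne_zero.2 (Ne.symm h)
    exact ⟨fun z => W z / (1 - z ^ 2), hW.div (by fun_prop) hden, EventuallyEq.rfl⟩

theorem add_analyticAt {g : ℂ → ℂ} (hf : RemovableAt f c) (hg : AnalyticAt ℂ g c) :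
    RemovableAt (fun z => f z + g z) c :=
  let ⟨h, hh, hfh⟩ := hf
  ⟨fun z => h z + g z, hh.add hg, hfh.add EventuallyEq.rfl⟩

end RemovableAt

theorem exists_zpow_mem_annulus {q : ℂ} (hq : ‖q‖ < 1) (hq0 : q ≠ 0) {c : ℂ} (hc : c ≠ 0) :
    ∃ k : ℤ, ‖q‖ < ‖c * q ^ k‖ ∧ ‖c * q ^ k‖ ≤ 1 := by
  have hr := norm_pos_iff.2 hq0
  obtain ⟨n, hlt, hle⟩ := exists_mem_Ioc_zpow (norm_pos_iff.2 hc) ((one_lt_inv₀ hr).2 hq)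
  rw [inv_zpow, inv_lt_iff_one_lt_mul₀ (zpow_pos hr n)] at hlt
  rw [inv_zpow, le_inv_comm₀ (norm_pos_iff.2 hc) (zpow_pos hr _), ← one_div,
    le_div_iff₀ (norm_pos_iff.2 hc)] at hle
  refine ⟨n + 1, ?_, ?_⟩
  · rw [norm_mul, norm_zpow, zpow_add_one₀ hr.ne', ← mul_assoc]
    exact lt_mul_of_one_lt_left hr hlt
  · rwa [norm_mul, norm_zpow, mul_comm]

section MulInvariant

variable {q : ℂ} {f : ℂ → ℂ}

theorem apply_mul_zpow_of_mul_invariant (hq0 : q ≠ 0) (hinv : ∀ z ≠ 0, f (z * q) = f z) (k : ℤ) :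
    ∀ z ≠ 0, f (z * q ^ k) = f z := by
  induction k with
  | zero => simp
  | succ k ih =>
    intro z hz
    rw [zpow_add_one₀ hq0, ← mul_assoc, hinv _ (mul_ne_zero hz (zpow_ne_zero _ hq0)), ih z hz]
  | pred k ih =>
    intro z hz
    rw [← hinv _ (mul_ne_zero hz (zpow_ne_zero _ hq0)), mul_assoc, ← zpow_add_one₀ hq0,
      sub_add_cancel, ih z hz]

theorem removableAt_of_mul_invariant (hq : ‖q‖ < 1) (hq0 : q ≠ 0)
    (hinv : ∀ z ≠ 0, f (z * q) = f z) (hf : ∀ c : ℂ, ‖q‖ < ‖c‖ → ‖c‖ ≤ 1 → RemovableAt f c)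
    {c : ℂ} (hc : c ≠ 0) : RemovableAt f c := by
  obtain ⟨k, hlt, hle⟩ := exists_zpow_mem_annulus hq hq0 hc
  refine ((hf _ hlt hle).comp_mul_const (zpow_ne_zero k hq0)).congr ?_
  filter_upwards [mem_nhdsWithin_of_mem_nhds (isOpen_ne.mem_nhds hc)] with z hz
  exact (apply_mul_zpow_of_mul_invariant hq0 hinv k z hz).symm

/-- Liouville's theorem on the torus `ℂˣ / q^ℤ`. -/
theorem eq_of_mul_invariant (hq : ‖q‖ < 1) (hq0 : q ≠ 0) (hf : ∀ z ≠ 0, AnalyticAt ℂ f z)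
    (hinv : ∀ z ≠ 0, f (z * q) = f z) {a b : ℂ} (ha : a ≠ 0) (hb : b ≠ 0) : f a = f b := by
  let A : Set ℂ := {z | ‖q‖ ≤ ‖z‖ ∧ ‖z‖ ≤ 1}
  have hdiff : Differentiable ℂ fun z => f (Complex.exp z) := fun z =>
    (hf _ (Complex.exp_ne_zero z)).differentiableAt.comp z Complex.differentiableAt_exp
  have hA : IsCompact A := by
    refine (isCompact_closedBall (0 : ℂ) 1).of_isClosed_subset ?_ fun z hz => by simpa using hz.2
    exact (isClosed_le continuous_const continuous_norm).inter
      (isClosed_le continuous_norm continuous_const)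
  have hfA : ContinuousOn f A := fun z hz =>
    (hf z (norm_pos_iff.1 ((norm_pos_iff.2 hq0).trans_le hz.1))).continuousAt.continuousWithinAt
  have hbounded : Bornology.IsBounded (Set.range fun z => f (Complex.exp z)) := by
    refine (hA.image_of_continuousOn hfA).isBounded.subset ?_
    rintro _ ⟨z, rfl⟩
    obtain ⟨k, hlt, hle⟩ := exists_zpow_mem_annulus hq hq0 (Complex.exp_ne_zero z)
    exact ⟨_, ⟨hlt.le, hle⟩,
      apply_mul_zpow_of_mul_invariant hq0 hinv k _ (Complex.exp_ne_zero z)⟩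
  simpa only [Complex.exp_log ha, Complex.exp_log hb] using
    hdiff.apply_eq_apply_of_bounded hbounded (Complex.log a) (Complex.log b)

theorem eq_of_mul_invariant_of_removableAt (hq : ‖q‖ < 1) (hq0 : q ≠ 0)
    (hf : ∀ c ≠ 0, RemovableAt f c) (hinv : ∀ z ≠ 0, f (z * q) = f z) {a b : ℂ} (ha : a ≠ 0)
    (hb : b ≠ 0) (hfa : ContinuousAt f a) (hfb : ContinuousAt f b) : f a = f b := by
  let F := toMeromorphicNFOn f {0}ᶜ
  have hmero : MeromorphicOn f {0}ᶜ := fun c hc => (hf c hc).meromorphicAt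
  have hFf : ∀ c ≠ 0, F =ᶠ[𝓝[≠] c] f := fun c hc => hmero.toMeromorphicNFOn_eq_self_on_nhdsNE hc
  have hF : ∀ c ≠ 0, AnalyticAt ℂ F c := fun c hc => by
    have hNF : MeromorphicNFAt F c := meromorphicNFOn_toMeromorphicNFOn f {0}ᶜ hc
    rw [← hNF.meromorphicOrderAt_nonneg_iff_analyticAt, meromorphicOrderAt_congr (hFf c hc)]
    exact (hf c hc).meromorphicOrderAt_nonneg
  have heq : ∀ {g : ℂ → ℂ} {c : ℂ}, c ≠ 0 → ContinuousAt g c → F =ᶠ[𝓝[≠] c] g → F c = g c :=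
    fun hc hg h =>
      (((hF _ hc).continuousAt.eventuallyEq_nhds_iff_eventuallyEq_nhdsNE hg).1 h).self_of_nhds
  have hFinv : ∀ c ≠ 0, F (c * q) = F c := fun c hc => by
    have hcq : c * q ≠ 0 := mul_ne_zero hc hq0
    have hshift : Tendsto (fun z => z * q) (𝓝[≠] c) (𝓝[≠] (c * q)) :=
      (hasDerivAt_mul_const q).tendsto_nhdsNE hq0
    refine (heq (g := fun z => F (z * q)) hc
      ((hF _ hcq).continuousAt.comp (f := fun z => z * q) (by fun_prop)) ?_).symm
    filter_upwards [hshift.eventually (hFf _ hcq), hFf c hc,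
      mem_nhdsWithin_of_mem_nhds (isOpen_ne.mem_nhds hc)] with z hzq hz hz0
    rw [hzq, hz, hinv z hz0]
  rw [← heq ha hfa (hFf a ha), ← heq hb hfb (hFf b hb)]
  exact eq_of_mul_invariant hq hq0 hF hFinv ha hb

end MulInvariant

/-! ### The partial fraction expansion of the theta quotient -/

theorem qPochInf_eq_one_sub_mul (x : ℂ) {q : ℂ} (hq : ‖q‖ < 1) :
    qPochInf x q = (1 - x) * qPochInf (x * q) q := by
  refine tendsto_nhds_unique
    ((tendsto_qPoch_qPochInf x hq).comp (tendsto_add_atTop_nat 1)) ?_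
  refine ((tendsto_qPoch_qPochInf (x * q) hq).const_mul (1 - x)).congr fun n => ?_
  exact (qPoch_succ_left x q n).symm

theorem qPochInf_one {q : ℂ} (hq : ‖q‖ < 1) : qPochInf 1 q = 0 := by
  rw [qPochInf_eq_one_sub_mul 1 hq, sub_self, zero_mul]

theorem norm_sq_lt_one {q : ℂ} (hq : ‖q‖ < 1) : ‖q ^ 2‖ < 1 := by
  rw [norm_pow]
  exact pow_lt_one₀ (norm_nonneg _) hq two_ne_zero

theorem mul_pow_ne_one_of_norm_lt_one {x q : ℂ} (hq : ‖q‖ < 1) (hx : ‖x‖ < 1) (k : ℕ) :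
    x * q ^ k ≠ 1 := fun h => by
  have hlt := (norm_mul_pow_le x hq k).trans_lt hx
  rw [h, norm_one] at hlt
  exact lt_irrefl 1 hlt

theorem qPochInf_mul_neg (x : ℂ) {q : ℂ} (hq : ‖q‖ < 1) :
    qPochInf x q * qPochInf (-x) q = qPochInf (x ^ 2) (q ^ 2) := by
  refine tendsto_nhds_unique
    ((tendsto_qPoch_qPochInf x hq).mul (tendsto_qPoch_qPochInf (-x) hq)) ?_
  refine (tendsto_qPoch_qPochInf (x ^ 2) (norm_sq_lt_one hq)).congr fun n => ?_
  rw [qPoch, qPoch, qPoch, ← Finset.prod_mul_distrib]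
  exact Finset.prod_congr rfl fun k _ => by ring

theorem qPochInf_ne_zero {x q : ℂ} (hq : ‖q‖ < 1) (h : ∀ k : ℕ, x * q ^ k ≠ 1) :
    qPochInf x q ≠ 0 := by
  have hprod := tprod_one_add_ne_zero_of_summable (f := fun k : ℕ => -(x * q ^ k))
    (fun k => by rw [← sub_eq_add_neg]; exact sub_ne_zero.2 (h k).symm)
    (by simpa using (summable_geometric_of_lt_one (norm_nonneg q) hq).mul_left ‖x‖)
  simpa only [qPochInf, sub_eq_add_neg] using hprod

theorem qPochInf_sq_sq_ne_zero {q : ℂ} (hq : ‖q‖ < 1) : qPochInf (q ^ 2) (q ^ 2) ≠ 0 :=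
  qPochInf_ne_zero (norm_sq_lt_one hq) fun k => by
    rw [← pow_succ']
    exact pow_succ_ne_one (norm_sq_lt_one hq) k

theorem differentiable_qPochInf {q : ℂ} (hq : ‖q‖ < 1) :
    Differentiable ℂ fun x => qPochInf x q := by
  intro x
  have hprod := Summable.hasProdLocallyUniformlyOn_nat_one_add
    (f := fun (k : ℕ) (y : ℂ) => -(y * q ^ k)) (K := Metric.ball 0 (‖x‖ + 1))
    (u := fun k => (‖x‖ + 1) * ‖q‖ ^ k) Metric.isOpen_ball
    ((summable_geometric_of_lt_one (norm_nonneg q) hq).mul_left _)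
    (Eventually.of_forall fun k y hy => by
      rw [mem_ball_zero_iff] at hy
      rw [norm_neg, norm_mul, norm_pow]
      gcongr)
    (fun k => by fun_prop)
  have hdiff : DifferentiableOn ℂ (fun y => ∏' k : ℕ, (1 + -(y * q ^ k)))
      (Metric.ball 0 (‖x‖ + 1)) :=
    hprod.differentiableOn (Eventually.of_forall fun _ => by
      simpa [Finset.prod_fn] using DifferentiableOn.finsetProd (fun _ _ => by fun_prop))
      Metric.isOpen_ball
  simpa only [qPochInf, sub_eq_add_neg] using
    hdiff.differentiableAt (Metric.isOpen_ball.mem_nhds (show x ∈ _ by simp))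

theorem analyticAt_qPochInf {q : ℂ} (hq : ‖q‖ < 1) {g : ℂ → ℂ} {z : ℂ} (hg : AnalyticAt ℂ g z) :
    AnalyticAt ℂ (fun x => qPochInf (g x) q) z :=
  ((differentiable_qPochInf hq).analyticAt (g z)).comp hg

theorem qPochInf_zero_right (x : ℂ) : qPochInf x 0 = 1 - x := by
  have hzero : ‖(0 : ℂ)‖ < 1 := by rw [norm_zero]; exact one_pos
  have h0 : qPochInf 0 0 = 1 := by simp [qPochInf]
  rw [qPochInf_eq_one_sub_mul x hzero, mul_zero, h0, mul_one]

/-- The modified theta function `(x, q/x; q)_∞`. -/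
noncomputable def qTheta (x q : ℂ) : ℂ := qPochInf x q * qPochInf (q / x) q

theorem qTheta_one {q : ℂ} (hq : ‖q‖ < 1) : qTheta 1 q = 0 := by
  rw [qTheta, qPochInf_one hq, zero_mul]

theorem qTheta_mul_right {x q : ℂ} (hq : ‖q‖ < 1) (hq0 : q ≠ 0) (hx : x ≠ 0) :
    qTheta (x * q) q = -x⁻¹ * qTheta x q := by
  rw [qTheta, qTheta, qPochInf_eq_one_sub_mul x hq,
    show q / (x * q) = x⁻¹ by field_simp, qPochInf_eq_one_sub_mul x⁻¹ hq,
    show x⁻¹ * q = q / x by ring]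
  field_simp
  ring

theorem qTheta_mul_neg (x : ℂ) {q : ℂ} (hq : ‖q‖ < 1) :
    qTheta x q * qTheta (-x) q = qTheta (x ^ 2) (q ^ 2) := by
  rw [qTheta, qTheta, qTheta, ← qPochInf_mul_neg x hq, ← div_pow, ← qPochInf_mul_neg (q / x) hq,
    div_neg]
  ring

theorem qTheta_ne_zero {x q : ℂ} (hq : ‖q‖ < 1) (h : ∀ n : ℤ, x * q ^ n ≠ 1) :
    qTheta x q ≠ 0 := by
  refine mul_ne_zero (qPochInf_ne_zero hq fun k => by simpa using h k)
    (qPochInf_ne_zero hq fun k hk => h (-(k + 1 : ℕ)) ?_)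
  have hx : x ≠ 0 := by
    rintro rfl
    simp at hk
  have hxq : q ^ (k + 1) = x := by
    field_simp at hk
    rw [pow_succ', hk]
  rw [zpow_neg, zpow_natCast, hxq, mul_inv_cancel₀ hx]

theorem analyticAt_qTheta {q : ℂ} (hq : ‖q‖ < 1) {g : ℂ → ℂ} {z : ℂ} (hg : AnalyticAt ℂ g z)
    (hz : g z ≠ 0) : AnalyticAt ℂ (fun x => qTheta (g x) q) z :=
  (analyticAt_qPochInf hq hg).mul (analyticAt_qPochInf hq (analyticAt_const.div hg hz))

theorem differentiableOn_bilateralHalf {q : ℂ} (hq : ‖q‖ < 1) :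
    DifferentiableOn ℂ (fun x => bilateralHalf x q) (Metric.ball 0 1) := by
  refine Complex.differentiableOn_tsum_of_summable_norm (summable_norm_pow_succ_div hq (1 - ‖q‖))
    (fun n x hx => ?_) Metric.isOpen_ball fun n x hx => ?_
  · rw [mem_ball_zero_iff] at hx
    have hden : 1 - x ^ 2 * q ^ (2 * (n + 1)) ≠ 0 :=
      sub_ne_zero.2 (mul_pow_ne_one_of_norm_lt_one hq (norm_sq_lt_one hx) _).symm
    unfold bilateralHalfTerm
    fun_prop (disch := assumption)
  · rw [mem_ball_zero_iff] at hx
    refine (norm_bilateralHalfTerm_le hq hx.le n).trans (mul_le_of_le_one_left ?_ hx.le)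
    have := sub_pos.2 hq
    positivity

theorem analyticAt_bilateralHalf {x q : ℂ} (hq : ‖q‖ < 1)
    (hx : ∀ n : ℕ, x ^ 2 * q ^ (2 * (n + 1)) ≠ 1) :
    AnalyticAt ℂ (fun y => bilateralHalf y q) x := by
  obtain ⟨N, hN⟩ := exists_norm_mul_pow_lt_one x hq
  rw [show (fun y => bilateralHalf y q) = _ from funext fun y => bilateralHalf_eq_sum_add y hq N]
  refine AnalyticAt.add (Finset.analyticAt_fun_sum _ fun n _ => ?_) ?_
  · have hden := sub_ne_zero.2 (hx n).symm
    unfold bilateralHalfTerm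
    fun_prop (disch := assumption)
  · refine AnalyticAt.comp (g := fun y => bilateralHalf y q) (f := fun y => y * q ^ N) ?_
      (by fun_prop)
    exact (differentiableOn_bilateralHalf hq).analyticAt
      (Metric.isOpen_ball.mem_nhds (mem_ball_zero_iff.2 hN))

/-- The bilateral series `∑_{m ∈ ℤ} x q^m / (1 - x² q^{2m})`: its terms of index `-m` are minus
the terms of index `m` for `x⁻¹` in place of `x`. -/
noncomputable def bilateralSum (x q : ℂ) : ℂ :=
  x / (1 - x ^ 2) + (bilateralHalf x q - bilateralHalf x⁻¹ q)

theorem bilateralSum_mul_right {x q : ℂ} (hq : ‖q‖ < 1) (hq0 : q ≠ 0) (hx : x ≠ 0) :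
    bilateralSum (x * q) q = bilateralSum x q := by
  have hinv := bilateralHalf_eq_add (x * q)⁻¹ hq
  rw [show (x * q)⁻¹ * q = x⁻¹ by field_simp, ← mul_pow,
    show (x * q)⁻¹ * q = x⁻¹ by field_simp] at hinv
  have hflip : x⁻¹ / (1 - x⁻¹ ^ 2) = -(x / (1 - x ^ 2)) := by
    rw [← mul_div_mul_right _ _ (pow_ne_zero 2 hx),
      show x⁻¹ * x ^ 2 = x by field_simp,
      show (1 - x⁻¹ ^ 2) * x ^ 2 = -(1 - x ^ 2) by field_simp; ring, div_neg]
  rw [bilateralSum, bilateralSum, hinv, hflip, bilateralHalf_eq_add x hq, mul_pow]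
  ring

theorem bilateralSum_zero_right (x : ℂ) : bilateralSum x 0 = x / (1 - x ^ 2) := by
  simp [bilateralSum, bilateralHalf, bilateralHalfTerm]

/-- The elliptic theta quotient in `a`, with simple poles at the points `±q^n` and a zero at
`a = b`. -/
noncomputable def thetaQuotient (a b q : ℂ) : ℂ :=
  a * (qTheta (b / a) q * qTheta (-a * b) q * qPochInf (q ^ 2) (q ^ 2) ^ 2) /
    (qTheta (a ^ 2) (q ^ 2) * qTheta (b ^ 2) (q ^ 2))

/-- The theta quotient with the factor `1 - a²` of its denominator removed, so that the poles at
`a = ±1` disappear. -/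
noncomputable def thetaQuotientReg (a b q : ℂ) : ℂ :=
  a * (qTheta (b / a) q * qTheta (-a * b) q * qPochInf (q ^ 2) (q ^ 2) ^ 2) /
    (qPochInf (a ^ 2 * q ^ 2) (q ^ 2) * qPochInf (q ^ 2 / a ^ 2) (q ^ 2) *
      qTheta (b ^ 2) (q ^ 2))

theorem thetaQuotient_eq_thetaQuotientReg_div (a b : ℂ) {q : ℂ} (hq : ‖q‖ < 1) :
    thetaQuotient a b q = thetaQuotientReg a b q / (1 - a ^ 2) := by
  have hfactor : qTheta (a ^ 2) (q ^ 2) =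
      (1 - a ^ 2) * qPochInf (a ^ 2 * q ^ 2) (q ^ 2) * qPochInf (q ^ 2 / a ^ 2) (q ^ 2) := by
    rw [qTheta, qPochInf_eq_one_sub_mul (a ^ 2) (norm_sq_lt_one hq)]
  rw [thetaQuotient, thetaQuotientReg, hfactor, div_div]
  congr 1
  ring

theorem thetaQuotient_self (b : ℂ) {q : ℂ} (hq : ‖q‖ < 1) (hb : b ≠ 0) :
    thetaQuotient b b q = 0 := by
  rw [thetaQuotient, div_self hb, qTheta_one hq, zero_mul, zero_mul, mul_zero, zero_div]

theorem thetaQuotient_mul_right {a b q : ℂ} (hq : ‖q‖ < 1) (hq0 : q ≠ 0) (ha : a ≠ 0)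
    (hb : b ≠ 0) : thetaQuotient (a * q) b q = thetaQuotient a b q := by
  have hba : qTheta (b / (a * q)) q = -(b / (a * q)) * qTheta (b / a) q := by
    rw [show b / a = b / (a * q) * q by field_simp, qTheta_mul_right hq hq0 (by positivity)]
    field_simp
  have hab : qTheta (-(a * q) * b) q = (a * b)⁻¹ * qTheta (-a * b) q := by
    rw [show -(a * q) * b = -a * b * q by ring,
      qTheta_mul_right hq hq0 (mul_ne_zero (neg_ne_zero.2 ha) hb), neg_mul a, inv_neg, neg_neg]
  have ha2 : qTheta ((a * q) ^ 2) (q ^ 2) = -(a ^ 2)⁻¹ * qTheta (a ^ 2) (q ^ 2) := by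
    rw [mul_pow]
    exact qTheta_mul_right (norm_sq_lt_one hq) (pow_ne_zero 2 hq0) (pow_ne_zero 2 ha)
  rw [thetaQuotient, thetaQuotient, hba, hab, ha2,
    ← mul_div_mul_left _ (qTheta (a ^ 2) (q ^ 2) * qTheta (b ^ 2) (q ^ 2))
      (neg_ne_zero.2 (inv_ne_zero (pow_ne_zero 2 ha)))]
  congr 1
  · field_simp
  · ring

theorem thetaQuotientReg_of_sq_eq_one {c b q : ℂ} (hq : ‖q‖ < 1)
    (hb : qTheta (b ^ 2) (q ^ 2) ≠ 0) (hc : c ^ 2 = 1) : thetaQuotientReg c b q = c := by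
  have hprod : qTheta (b / c) q * qTheta (-c * b) q = qTheta (b ^ 2) (q ^ 2) := by
    rcases sq_eq_one_iff.1 hc with rfl | rfl
    · rw [← qTheta_mul_neg b hq, div_one, neg_one_mul]
    · rw [← qTheta_mul_neg b hq, div_neg, div_one, neg_neg, one_mul, mul_comm]
  have hP := qPochInf_sq_sq_ne_zero hq
  rw [thetaQuotientReg, hprod, hc, one_mul, div_one]
  field_simp

theorem analyticAt_thetaQuotientReg {c b q : ℂ} (hq : ‖q‖ < 1) (hc0 : c ≠ 0) (hb : b ≠ 0)
    (hbq : qTheta (b ^ 2) (q ^ 2) ≠ 0) (hc : ∀ n : ℕ, c ^ 2 * q ^ (2 * (n + 1)) ≠ 1)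
    (hc' : ∀ n : ℕ, c⁻¹ ^ 2 * q ^ (2 * (n + 1)) ≠ 1) :
    AnalyticAt ℂ (fun z => thetaQuotientReg z b q) c := by
  have hq2 := norm_sq_lt_one hq
  have hden : qPochInf (c ^ 2 * q ^ 2) (q ^ 2) ≠ 0 := qPochInf_ne_zero hq2 fun k h =>
    hc k (by rw [← h]; ring)
  have hden' : qPochInf (q ^ 2 / c ^ 2) (q ^ 2) ≠ 0 := qPochInf_ne_zero hq2 fun k h =>
    hc' k (by rw [← h]; ring)
  have hsq : c ^ 2 ≠ 0 := pow_ne_zero 2 hc0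
  have hba := analyticAt_qTheta hq (g := fun z => b / z) (z := c)
    (by fun_prop (disch := assumption)) (div_ne_zero hb hc0)
  have hab := analyticAt_qTheta hq (g := fun z => -z * b) (z := c) (by fun_prop)
    (mul_ne_zero (neg_ne_zero.2 hc0) hb)
  have hP := analyticAt_qPochInf hq2 (g := fun z => z ^ 2 * q ^ 2) (z := c) (by fun_prop)
  have hP' := analyticAt_qPochInf hq2 (g := fun z => q ^ 2 / z ^ 2) (z := c)
    (by fun_prop (disch := assumption))
  exact (analyticAt_id.mul ((hba.mul hab).mul analyticAt_const)).div
    ((hP.mul hP').mul analyticAt_const) (mul_ne_zero (mul_ne_zero hden hden') hbq)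

/-- The difference of the two sides of the partial fraction expansion of `thetaQuotient z b q`. -/
noncomputable def partialFractionDefect (b q z : ℂ) : ℂ :=
  bilateralSum z q - bilateralSum b q - thetaQuotient z b q

section PartialFraction

variable {b c q : ℂ}

theorem partialFractionDefect_mul_right (hq : ‖q‖ < 1) (hq0 : q ≠ 0) (hb : b ≠ 0) (hc : c ≠ 0) :
    partialFractionDefect b q (c * q) = partialFractionDefect b q c := by
  rw [partialFractionDefect, partialFractionDefect, bilateralSum_mul_right hq hq0 hc,
    thetaQuotient_mul_right hq hq0 hc hb]

theorem partialFractionDefect_eq (b : ℂ) (hq : ‖q‖ < 1) :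
    partialFractionDefect b q = fun z => (z - thetaQuotientReg z b q) / (1 - z ^ 2) +
      (bilateralHalf z q - bilateralHalf z⁻¹ q - bilateralSum b q) := by
  funext z
  rw [partialFractionDefect, thetaQuotient_eq_thetaQuotientReg_div z b hq, bilateralSum]
  ring

theorem analyticAt_bilateralHalf_sub (hq : ‖q‖ < 1) (hc0 : c ≠ 0)
    (hc : ∀ n : ℕ, c ^ 2 * q ^ (2 * (n + 1)) ≠ 1)
    (hc' : ∀ n : ℕ, c⁻¹ ^ 2 * q ^ (2 * (n + 1)) ≠ 1) :
    AnalyticAt ℂ (fun z => bilateralHalf z q - bilateralHalf z⁻¹ q) c :=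
  (analyticAt_bilateralHalf hq hc).sub
    (AnalyticAt.comp (g := fun z => bilateralHalf z q) (analyticAt_bilateralHalf hq hc')
      (analyticAt_inv hc0))

theorem removableAt_partialFractionDefect (hq : ‖q‖ < 1) (hb : b ≠ 0)
    (hbq : qTheta (b ^ 2) (q ^ 2) ≠ 0) (hc0 : c ≠ 0)
    (hc : ∀ n : ℕ, c ^ 2 * q ^ (2 * (n + 1)) ≠ 1)
    (hc' : ∀ n : ℕ, c⁻¹ ^ 2 * q ^ (2 * (n + 1)) ≠ 1) :
    RemovableAt (partialFractionDefect b q) c := by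
  rw [partialFractionDefect_eq b hq]
  refine (RemovableAt.div_one_sub_sq ?_ fun h => ?_).add_analyticAt
    ((analyticAt_bilateralHalf_sub hq hc0 hc hc').sub analyticAt_const)
  · exact analyticAt_id.sub (analyticAt_thetaQuotientReg hq hc0 hb hbq hc hc')
  · rw [thetaQuotientReg_of_sq_eq_one hq hbq h, sub_self]

theorem removableAt_partialFractionDefect_of_mem_annulus (hq : ‖q‖ < 1) (hb : b ≠ 0)
    (hbq : qTheta (b ^ 2) (q ^ 2) ≠ 0) (hlt : ‖q‖ < ‖c‖) (hle : ‖c‖ ≤ 1) :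
    RemovableAt (partialFractionDefect b q) c := by
  have hpos : 0 < ‖c‖ := (norm_nonneg q).trans_lt hlt
  have hne : ∀ y : ℂ, ‖y * q‖ < 1 → ∀ n : ℕ, y ^ 2 * q ^ (2 * (n + 1)) ≠ 1 := fun y hy n h =>
    mul_pow_ne_one_of_norm_lt_one hq (norm_sq_lt_one hy) (2 * n) (by rw [← h]; ring)
  refine removableAt_partialFractionDefect hq hb hbq (norm_pos_iff.1 hpos) (hne c ?_) (hne c⁻¹ ?_)
  · rw [norm_mul]
    exact mul_lt_one_of_nonneg_of_lt_one_right hle (norm_nonneg q) hq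
  · rwa [norm_mul, norm_inv, inv_mul_lt_one₀ hpos]

theorem continuousAt_partialFractionDefect (hq : ‖q‖ < 1) (hb : b ≠ 0)
    (hbq : qTheta (b ^ 2) (q ^ 2) ≠ 0) (hc0 : c ≠ 0) (hc1 : c ^ 2 ≠ 1)
    (hc : ∀ n : ℕ, c ^ 2 * q ^ (2 * (n + 1)) ≠ 1)
    (hc' : ∀ n : ℕ, c⁻¹ ^ 2 * q ^ (2 * (n + 1)) ≠ 1) :
    ContinuousAt (partialFractionDefect b q) c := by
  rw [partialFractionDefect_eq b hq]
  have hreg := (analyticAt_thetaQuotientReg hq hc0 hb hbq hc hc').continuousAt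
  have hhalf := (analyticAt_bilateralHalf_sub hq hc0 hc hc').continuousAt
  have hden : 1 - c ^ 2 ≠ 0 := sub_ne_zero.2 hc1.symm
  fun_prop (disch := assumption)

end PartialFraction

theorem inv_sq_mul_zpow_ne_one {x q : ℂ} (hx : ∀ n : ℤ, x ^ 2 * q ^ n ≠ 1) (n : ℤ) :
    x⁻¹ ^ 2 * q ^ n ≠ 1 := by
  rw [Ne, ← inv_inj, mul_inv, inv_pow, inv_inv, ← zpow_neg, inv_one]
  exact hx (-n)

theorem sq_mul_pow_ne_one {x q : ℂ} (hx : ∀ n : ℤ, x ^ 2 * q ^ n ≠ 1) (k : ℕ) :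
    x ^ 2 * q ^ k ≠ 1 := by
  exact_mod_cast hx k

theorem sq_ne_one {x q : ℂ} (hx : ∀ n : ℤ, x ^ 2 * q ^ n ≠ 1) : x ^ 2 ≠ 1 := by
  simpa only [zpow_zero, mul_one] using hx 0

theorem thetaQuotient_zero_right {a b : ℂ} (ha : a ≠ 0) (ha2 : a ^ 2 ≠ 1) (hb2 : b ^ 2 ≠ 1) :
    thetaQuotient a b 0 = a / (1 - a ^ 2) - b / (1 - b ^ 2) := by
  have ha2' := sub_ne_zero.2 ha2.symm
  have hb2' := sub_ne_zero.2 hb2.symm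
  simp only [thetaQuotient, qTheta, ne_eq, OfNat.ofNat_ne_zero, not_false_eq_true, zero_pow,
    zero_div, qPochInf_zero_right]
  field_simp
  ring

theorem thetaQuotient_eq_bilateralSum_sub {a b q : ℂ} (hq : ‖q‖ < 1) (ha : a ≠ 0) (hb : b ≠ 0)
    (haq : ∀ n : ℤ, a ^ 2 * q ^ n ≠ 1) (hbq : ∀ n : ℤ, b ^ 2 * q ^ n ≠ 1) :
    thetaQuotient a b q = bilateralSum a q - bilateralSum b q := by
  rcases eq_or_ne q 0 with rfl | hq0
  · rw [thetaQuotient_zero_right ha (sq_ne_one haq) (sq_ne_one hbq), bilateralSum_zero_right,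
      bilateralSum_zero_right]
  have hT : qTheta (b ^ 2) (q ^ 2) ≠ 0 := qTheta_ne_zero (norm_sq_lt_one hq) fun n => by
    rw [← zpow_natCast q 2, ← zpow_mul]
    exact hbq (_ * n)
  have hcont : ∀ {c : ℂ}, c ≠ 0 → (∀ n : ℤ, c ^ 2 * q ^ n ≠ 1) →
      ContinuousAt (partialFractionDefect b q) c := fun hc hcq =>
    continuousAt_partialFractionDefect hq hb hT hc (sq_ne_one hcq)
      (fun _ => sq_mul_pow_ne_one hcq _)
      (fun _ => sq_mul_pow_ne_one (inv_sq_mul_zpow_ne_one hcq) _)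
  have hinv : ∀ z ≠ 0, partialFractionDefect b q (z * q) = partialFractionDefect b q z :=
    fun _ => partialFractionDefect_mul_right hq hq0 hb
  have hremovable : ∀ c ≠ 0, RemovableAt (partialFractionDefect b q) c := fun _ =>
    removableAt_of_mul_invariant hq hq0 hinv fun _ =>
      removableAt_partialFractionDefect_of_mem_annulus hq hb hT
  have hab : partialFractionDefect b q a = partialFractionDefect b q b :=
    eq_of_mul_invariant_of_removableAt hq hq0 hremovable hinv ha hb (hcont ha haq) (hcont hb hbq)
  rw [partialFractionDefect, partialFractionDefect, thetaQuotient_self b hq hb, sub_self,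
    sub_zero] at hab
  exact (sub_eq_zero.1 hab).symm

theorem lambertTerm_eq (a b q : ℂ) (n : ℕ) :
    lambertTerm a b q n = lambertHalfTerm b q n - lambertHalfTerm a q n +
      lambertHalfTerm a⁻¹ q n - lambertHalfTerm b⁻¹ q n := by
  have hexp : 2 * n ^ 2 + 3 * n + 1 = (2 * n + 1) * (n + 1) := by ring
  simp only [lambertTerm, lambertHalfTerm, inv_pow, hexp]
  ring

theorem hasSum_lambertTerm (a b : ℂ) {q : ℂ} (hq : ‖q‖ < 1) :
    HasSum (fun n => lambertTerm a b q n)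
      (lambertHalf b q - lambertHalf a q + lambertHalf a⁻¹ q - lambertHalf b⁻¹ q) := by
  simp only [lambertTerm_eq]
  exact (((hasSum_lambertHalf b hq).sub (hasSum_lambertHalf a hq)).add
    (hasSum_lambertHalf a⁻¹ hq)).sub (hasSum_lambertHalf b⁻¹ hq)

theorem wellPoisedKernel_mul_eq {x : ℂ} (q : ℂ) (hx : x ≠ 1) (n : ℕ) :
    wellPoisedKernel x q n * (1 - x * q ^ (2 * (n + 1))) =
      wellPoisedCoeff q n * ((1 - x * q ^ (2 * (n + 1))) * qPoch x q (n + 1) /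
        ((1 - x) * qPoch (q * x ^ 2) q (2 * (n + 1))) * x ^ (2 * (n + 1))) := by
  rw [wellPoisedKernel, qPoch_succ_left, mul_left_comm _ (1 - x),
    mul_div_mul_left _ _ (sub_ne_zero.2 hx.symm), mul_comm q]
  ring

/-- The bracket of the well-poised series that belongs to one of `a`, `b`, `1 / a`, `1 / b`. -/
noncomputable def wellPoisedBracket (x q : ℂ) (n : ℕ) : ℂ :=
  (1 - x * q ^ (2 * n)) * qPoch x q n / ((1 - x) * qPoch (q * x ^ 2) q (2 * n)) * x ^ (2 * n) -
    (1 + x * q ^ (2 * n)) * qPoch (-x) q n / ((1 + x) * qPoch (q * x ^ 2) q (2 * n)) * x ^ (2 * n)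

theorem hasSum_wellPoisedBracket {x q : ℂ} (hq : ‖q‖ < 1) (hx : ∀ n : ℤ, x ^ 2 * q ^ n ≠ 1) :
    HasSum (fun n => wellPoisedCoeff q n * wellPoisedBracket x q (n + 1))
      (2 * (bilateralHalf x q - lambertHalf x q)) := by
  have hreg : ∀ k : ℕ, x ^ 2 * q ^ (k + 1) ≠ 1 := fun k => sq_mul_pow_ne_one hx (k + 1)
  have hpos : x ≠ 1 := fun h => sq_ne_one hx (by rw [h, one_pow])
  have hneg : -x ≠ 1 := fun h => sq_ne_one hx (by rw [← neg_sq, h, one_pow])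
  have hterm : ∀ n, wellPoisedCoeff q n * wellPoisedBracket x q (n + 1) =
      wellPoisedKernel x q n * (1 - x * q ^ (2 * (n + 1))) -
        wellPoisedKernel (-x) q n * (1 - -x * q ^ (2 * (n + 1))) := fun n => by
    rw [wellPoisedKernel_mul_eq q hpos, wellPoisedKernel_mul_eq q hneg, ← mul_sub,
      wellPoisedBracket, neg_sq, (even_two_mul (n + 1)).neg_pow, neg_mul, sub_neg_eq_add,
      sub_neg_eq_add]
  simp only [hterm, ← wellPoisedSum_sub_neg hq hreg]
  exact (hasSum_wellPoisedSum hq hreg).sub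
    (hasSum_wellPoisedSum hq (by simpa only [neg_sq] using hreg))

theorem wellPoisedTerm_succ (a b q : ℂ) (n : ℕ) :
    wellPoisedTerm a b q (n + 1) =
      wellPoisedCoeff q n * wellPoisedBracket a q (n + 1) -
        wellPoisedCoeff q n * wellPoisedBracket b q (n + 1) -
        wellPoisedCoeff q n * wellPoisedBracket a⁻¹ q (n + 1) +
        wellPoisedCoeff q n * wellPoisedBracket b⁻¹ q (n + 1) := by
  have hcoeff : (-1) ^ (n + 1) * q ^ ((n + 1) * (n + 1 + 1) / 2) * qPoch q q (2 * (n + 1) - 1) /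
      qPoch q q (n + 1) = wellPoisedCoeff q n := rfl
  have hbase (z : ℂ) : q / z ^ 2 = q * z⁻¹ ^ 2 := by rw [inv_pow, div_eq_mul_inv]
  rw [wellPoisedTerm, hcoeff]
  simp only [wellPoisedBracket, hbase, neg_div, one_div, div_eq_inv_mul (q ^ _), inv_pow]
  ring

theorem hasSum_wellPoisedTerm {a b q : ℂ} (hq : ‖q‖ < 1) (haq : ∀ n : ℤ, a ^ 2 * q ^ n ≠ 1)
    (hbq : ∀ n : ℤ, b ^ 2 * q ^ n ≠ 1) :
    HasSum (fun n => wellPoisedTerm a b q (n + 1))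
      (2 * (bilateralHalf a q - lambertHalf a q) - 2 * (bilateralHalf b q - lambertHalf b q) -
        2 * (bilateralHalf a⁻¹ q - lambertHalf a⁻¹ q) +
        2 * (bilateralHalf b⁻¹ q - lambertHalf b⁻¹ q)) := by
  simp only [wellPoisedTerm_succ]
  exact (((hasSum_wellPoisedBracket hq haq).sub (hasSum_wellPoisedBracket hq hbq)).sub
    (hasSum_wellPoisedBracket hq (inv_sq_mul_zpow_ne_one haq))).add
    (hasSum_wellPoisedBracket hq (inv_sq_mul_zpow_ne_one hbq))

theorem thetaQuotient_eq_mul_qPochInf (a b q : ℂ) :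
    thetaQuotient a b q =
      a * ((qPochInf (b / a) q * qPochInf (q * a / b) q * qPochInf (-a * b) q *
          qPochInf (-q / (a * b)) q * (qPochInf (q ^ 2) (q ^ 2) * qPochInf (q ^ 2) (q ^ 2))) /
        (qPochInf (a ^ 2) (q ^ 2) * qPochInf (q ^ 2 / a ^ 2) (q ^ 2) *
          qPochInf (b ^ 2) (q ^ 2) * qPochInf (q ^ 2 / b ^ 2) (q ^ 2))) := by
  have hba : q / (b / a) = q * a / b := div_div_eq_mul_div q b a
  have hab : q / (-a * b) = -q / (a * b) := by rw [neg_mul, div_neg, neg_div]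
  simp only [thetaQuotient, qTheta, hba, hab]
  ring

theorem corollary2 (a b q : ℂ) (hq : ‖q‖ < 1) (ha : a ≠ 0) (hb : b ≠ 0)
    (haq : ∀ n : ℤ, a ^ 2 * q ^ n ≠ 1) (hbq : ∀ n : ℤ, b ^ 2 * q ^ n ≠ 1) :
    Summable (fun n : ℕ => lambertTerm a b q n) ∧
    Summable (fun n : ℕ => wellPoisedTerm a b q (n + 1)) ∧
    (∑' n : ℕ, lambertTerm a b q n) - 1 / 2 * ∑' n : ℕ, wellPoisedTerm a b q (n + 1) =
      (a - b) * (1 + a * b) / ((1 - a ^ 2) * (1 - b ^ 2)) -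
        a * ((qPochInf (b / a) q * qPochInf (q * a / b) q * qPochInf (-a * b) q *
              qPochInf (-q / (a * b)) q * (qPochInf (q ^ 2) (q ^ 2) * qPochInf (q ^ 2) (q ^ 2))) /
            (qPochInf (a ^ 2) (q ^ 2) * qPochInf (q ^ 2 / a ^ 2) (q ^ 2) *
              qPochInf (b ^ 2) (q ^ 2) * qPochInf (q ^ 2 / b ^ 2) (q ^ 2))) := by
  have hL := hasSum_lambertTerm a b hq
  have hW := hasSum_wellPoisedTerm hq haq hbq
  have hrat : (a - b) * (1 + a * b) / ((1 - a ^ 2) * (1 - b ^ 2)) =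
      a / (1 - a ^ 2) - b / (1 - b ^ 2) := by
    rw [div_sub_div _ _ (sub_ne_zero.2 (sq_ne_one haq).symm) (sub_ne_zero.2 (sq_ne_one hbq).symm)]
    ring
  refine ⟨hL.summable, hW.summable, ?_⟩
  rw [hL.tsum_eq, hW.tsum_eq, hrat, ← thetaQuotient_eq_mul_qPochInf,
    thetaQuotient_eq_bilateralSum_sub hq ha hb haq hbq, bilateralSum, bilateralSum]
  ring
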